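/- Let $\mathbb F$ be $\mathbb R$ or $\mathbb C$, with complex conjugation as involution. A *-algebra is a unital associative $\mathbb F$-algebra $\mathcal A$ with a (conjugate-linear, antimultiplicative) involution $*$. A *-ideal is a left ideal $I$ with $I^*=I$ (it is then two-sided). A left ideal $I$ is real if $\sum_{j=1}^n a_j^*a_j\in I+I^*$ with $a_1,\dots,a_n\in\mathcal A$ implies $a_j\in I$ for all $j$; the real radical $\sqrt[\mathrm{real}]{I}$ is the intersection of all real left ideals containing $I$. The *-algebra $\mathcal A$ is formally real if $\sum_{j=1}^n a_j^*a_j=0$ implies $a_1=\dots=a_n=0$. A *-representation of $\mathcal A$ is a unital *-homomorphism $\pi$ from $\mathcal A$ to the *-algebra of adjointable linear operators on a (not necessarily complete) pre-Hilbert space over $\mathbb F$; $\mathcal A$ is $O^*$-representable if it has an injective *-representation. A representation class is an arbitrary class $\mathcal C$ of *-representations of $\mathcal A$, and a *-ideal $I$ satisfies the real Nullstellensatz over $\mathcal C$ if $$\{a\in\mathcal A:\ \pi(a)=0 \text{ for every } \pi\in\mathcal C \text{ with } \pi|_I=0\}=\sqrt[\mathrm{real}]{I}.$$ **Proposition 1.7.**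 Fix a real number $q$ with $0<q<1$. Let $\mathcal A=\mathbb F\langle a,x,a^*,x^*\rangle$ be the free *-algebra in the two variables $a$ and $x$, and let $I$ be the *-ideal of $\mathcal A$ generated by $$a^*a-q\,aa^*\quad\text{and}\quad xx^*+aa^*-1 .$$ Then $I$ is real, but $I$ does not satisfy the real Nullstellensatz over any representation class of $\mathcal A$. Moreover, the quotient *-algebra $\mathcal A/I$ is formally real but not $O^*$-representable. -/

import Mathlib

universe u v w

/-! ### Ideals in *-algebras

A *-algebra over `F = ℝ` or `ℂ` is a ring `A` with `[Algebra F A] [StarRing A] [StarModule F A]`: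
the involution is additive, antimultiplicative and conjugate-linear.  `Ideal A` is the type of
left ideals of `A`. -/

section StarIdeals

variable {A : Type v} [Ring A] [StarRing A]

/-- A left ideal `I` is a *-ideal if `I* = I`. -/
class Ideal.IsStarIdeal (I : Ideal A) : Prop where
  star_mem_iff : ∀ a : A, star a ∈ I ↔ a ∈ I

/-- A *-ideal is automatically two-sided. -/
instance Ideal.IsStarIdeal.isTwoSided (I : Ideal A) [hI : I.IsStarIdeal] : I.IsTwoSided where
  mul_mem_of_left {a} b ha := by
    rw [← hI.star_mem_iff, star_mul]
    exact I.mul_mem_left _ ((hI.star_mem_iff a).2 ha)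

/-- The *-ideal generated by `S`: the smallest *-ideal that contains `S`. -/
def starIdealSpan (S : Set A) : Ideal A :=
  sInf {J : Ideal A | J.IsStarIdeal ∧ S ⊆ J}

instance starIdealSpan.isStarIdeal (S : Set A) : (starIdealSpan S).IsStarIdeal where
  star_mem_iff a := by
    simp only [starIdealSpan, Submodule.mem_sInf]
    exact forall₂_congr fun J hJ => hJ.1.star_mem_iff a

/-- A left ideal `I` is real if `∑ aⱼ* aⱼ ∈ I + I*` implies that every `aⱼ ∈ I`. -/
def Ideal.IsReal (I : Ideal A) : Prop :=
  ∀ (n : ℕ) (a : Fin n → A),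
    (∃ u ∈ I, ∃ v ∈ I, ∑ j, star (a j) * a j = u + star v) → ∀ j, a j ∈ I

/-- The real radical of a left ideal: the intersection of all real left ideals containing it. -/
def Ideal.realRadical (I : Ideal A) : Ideal A :=
  sInf {J : Ideal A | J.IsReal ∧ I ≤ J}

/-- The involution `star (a + I) = star a + I` on the quotient by a *-ideal. -/
instance Ideal.Quotient.starRing (I : Ideal A) [hI : I.IsStarIdeal] : StarRing (A ⧸ I) where
  star := Quotient.map' star fun a b hab => by
    rw [Submodule.quotientRel_def] at hab ⊢
    rw [← star_sub]
    exact (hI.star_mem_iff _).2 hab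
  star_involutive := by
    rintro ⟨a⟩
    exact congrArg (Ideal.Quotient.mk I) (star_star a)
  star_mul := by
    rintro ⟨a⟩ ⟨b⟩
    exact congrArg (Ideal.Quotient.mk I) (star_mul a b)
  star_add := by
    rintro ⟨a⟩ ⟨b⟩
    exact congrArg (Ideal.Quotient.mk I) (star_add a b)

theorem Ideal.Quotient.star_mk (I : Ideal A) [I.IsStarIdeal] (a : A) :
    star (Ideal.Quotient.mk I a) = Ideal.Quotient.mk I (star a) := rfl

instance Ideal.Quotient.starModule {F : Type w} [CommRing F] [StarRing F] [Algebra F A]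
    [StarModule F A] (I : Ideal A) [I.IsStarIdeal] : StarModule F (A ⧸ I) where
  star_smul := by
    rintro c ⟨a⟩
    exact congrArg (Ideal.Quotient.mk I) (star_smul c a)

variable (A) in
/-- A *-algebra is formally real if `∑ aⱼ* aⱼ = 0` implies that every `aⱼ = 0`. -/
def StarFormallyReal : Prop :=
  ∀ (n : ℕ) (a : Fin n → A), ∑ j, star (a j) * a j = 0 → ∀ j, a j = 0

end StarIdeals

/-! ### Representations on pre-Hilbert spaces -/

section Representations

variable (F : Type w) [RCLike F] (A : Type v) [Ring A] [Algebra F A] [StarRing A]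

/-- A *-representation of `A`: a unital *-homomorphism `π` into the adjointable operators on a
pre-Hilbert space `V` over `F` (not assumed complete), that is, a unital algebra homomorphism into
the linear operators on `V` such that `π (star a)` is an adjoint of `π a`. -/
structure StarRep where
  /-- the pre-Hilbert space -/
  V : Type u
  [instNormedAddCommGroup : NormedAddCommGroup V]
  [instInnerProductSpace : InnerProductSpace F V]
  /-- the homomorphism -/
  π : A →ₐ[F] Module.End F V
  inner_star : ∀ (a : A) (v w : V), inner F (π a v) w = inner F v (π (star a) w)

attribute [instance] StarRep.instNormedAddCommGroup StarRep.instInnerProductSpace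

/-- A *-algebra is O*-representable if it has a faithful *-representation. -/
def IsOStarRepresentable : Prop :=
  ∃ ρ : StarRep.{u} F A, Function.Injective ρ.π

variable {F A}

/-- The hard vanishing set of a set `T` of *-representations. -/
def hardVanishingSet (T : Set (StarRep.{u} F A)) : Set A :=
  {a : A | ∀ ρ ∈ T, ρ.π a = 0}

/-- The hard variety of `S ⊆ A` over the representation class `C`. -/
def hardVariety (C : Set (StarRep.{u} F A)) (S : Set A) : Set (StarRep.{u} F A) :=
  {ρ | ρ ∈ C ∧ ∀ s ∈ S, ρ.π s = 0}

/-- The hard radical of `S ⊆ A` over the representation class `C`. -/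
def hardRadical (C : Set (StarRep.{u} F A)) (S : Set A) : Set A :=
  hardVanishingSet (hardVariety C S)

/-- `I` satisfies the real Nullstellensatz over the representation class `C`: its hard radical
over `C` equals its real radical. -/
def SatisfiesRealNullstellensatz (C : Set (StarRep.{u} F A)) (I : Ideal A) : Prop :=
  hardRadical C (I : Set A) = (I.realRadical : Set A)

end Representations

/-! ### Free *-algebras -/

/-- The free *-algebra on a set `G` of variables: the free `F`-algebra on the letters
`(g, false)`, standing for `g`, and `(g, true)`, standing for `g*`. -/
def FreeStarAlgebra (F : Type w) [RCLike F] (G : Type v) : Type (max v w) :=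
  FreeAlgebra F (G × Bool)

namespace FreeStarAlgebra

variable (F : Type w) [RCLike F] {G : Type v}

noncomputable instance : Ring (FreeStarAlgebra F G) :=
  inferInstanceAs (Ring (FreeAlgebra F (G × Bool)))

noncomputable instance : Algebra F (FreeStarAlgebra F G) :=
  inferInstanceAs (Algebra F (FreeAlgebra F (G × Bool)))

/-- The letter `g` (for `b = false`) or `g*` (for `b = true`). -/
noncomputable def letter (g : G) (b : Bool) : FreeStarAlgebra F G :=
  FreeAlgebra.ι F (g, b)

/-- The variable `g`. -/
noncomputable def var (g : G) : FreeStarAlgebra F G := letter F g false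

/-- The opposite of the free algebra, where scalars act through complex conjugation. -/
noncomputable abbrev conjAlgebra : Algebra F (FreeStarAlgebra F G)ᵐᵒᵖ :=
  Algebra.compHom (FreeStarAlgebra F G)ᵐᵒᵖ (starRingEnd F)

/-- The involution, as a ring homomorphism to the opposite algebra: it is conjugate-linear,
reverses words, and exchanges `g` and `g*`. -/
noncomputable def starHom : FreeStarAlgebra F G →+* (FreeStarAlgebra F G)ᵐᵒᵖ :=
  letI := conjAlgebra F (G := G)
  (FreeAlgebra.lift F (A := (FreeStarAlgebra F G)ᵐᵒᵖ)
    fun x : G × Bool => MulOpposite.op (letter F x.1 (!x.2))).toRingHom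

variable {F}

theorem starHom_letter (g : G) (b : Bool) :
    starHom F (letter F g b) = MulOpposite.op (letter F g (!b)) := by
  let := conjAlgebra F (G := G)
  exact FreeAlgebra.lift_ι_apply (R := F) (A := (FreeStarAlgebra F G)ᵐᵒᵖ) _ _

theorem starHom_algebraMap (c : F) :
    starHom F (algebraMap F (FreeStarAlgebra F G) c) =
      MulOpposite.op (algebraMap F (FreeStarAlgebra F G) (star c)) := by
  let := conjAlgebra F (G := G)
  exact (FreeAlgebra.lift F (A := (FreeStarAlgebra F G)ᵐᵒᵖ)
    fun x : G × Bool => MulOpposite.op (letter F x.1 (!x.2))).commutes c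

theorem starHom_starHom (p : FreeStarAlgebra F G) :
    (starHom F (starHom F p).unop).unop = p := by
  refine FreeAlgebra.induction (R := F) (X := G × Bool)
    (motive := fun p : FreeStarAlgebra F G => (starHom F (starHom F p).unop).unop = p)
    ?_ ?_ ?_ ?_ p
  · intro c
    have h := starHom_algebraMap (G := G) c
    have h' := starHom_algebraMap (G := G) (star c)
    rw [star_star] at h'
    exact (congrArg (fun y => (starHom F y.unop).unop) h).trans (congrArg MulOpposite.unop h')
  · rintro ⟨g, b⟩
    have h := starHom_letter (F := F) g b
    have h' := starHom_letter (F := F) g (!b)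
    rw [Bool.not_not] at h'
    exact (congrArg (fun y => (starHom F y.unop).unop) h).trans (congrArg MulOpposite.unop h')
  · exact fun (a b : FreeStarAlgebra F G)
        (ha : (starHom F (starHom F a).unop).unop = a)
        (hb : (starHom F (starHom F b).unop).unop = b) => by
      show (starHom F (starHom F (a * b)).unop).unop = a * b
      rw [map_mul, MulOpposite.unop_mul, map_mul, MulOpposite.unop_mul, ha, hb]
  · exact fun (a b : FreeStarAlgebra F G)
        (ha : (starHom F (starHom F a).unop).unop = a)
        (hb : (starHom F (starHom F b).unop).unop = b) => by
      show (starHom F (starHom F (a + b)).unop).unop = a + b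
      rw [map_add, MulOpposite.unop_add, map_add, MulOpposite.unop_add, ha, hb]

noncomputable instance : StarRing (FreeStarAlgebra F G) where
  star p := (starHom F p).unop
  star_involutive := starHom_starHom
  star_mul a b := by rw [map_mul, MulOpposite.unop_mul]
  star_add a b := by rw [map_add, MulOpposite.unop_add]

theorem star_letter (g : G) (b : Bool) : star (letter F g b) = letter F g (!b) :=
  congrArg MulOpposite.unop (starHom_letter g b)

theorem star_algebraMap (c : F) :
    star (algebraMap F (FreeStarAlgebra F G) c) = algebraMap F (FreeStarAlgebra F G) (star c) :=
  congrArg MulOpposite.unop (starHom_algebraMap c)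

instance : StarModule F (FreeStarAlgebra F G) where
  star_smul c p := by
    rw [Algebra.smul_def, star_mul, star_algebraMap, ← Algebra.commutes, Algebra.smul_def]

end FreeStarAlgebra

/-! ### The ideal -/

/-- The two variables `a` and `x`. -/
inductive AXVar : Type
  | a
  | x

/-- The *-ideal of `F⟨a, x, a*, x*⟩` generated by `a* a - q a a*` and `x x* + a a* - 1`. -/
noncomputable def axIdeal (F : Type w) [RCLike F] (q : ℝ) : Ideal (FreeStarAlgebra F AXVar) :=
  let a := FreeStarAlgebra.var F AXVar.a
  let x := FreeStarAlgebra.var F AXVar.x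
  starIdealSpan {star a * a - (q : F) • (a * star a), x * star x + a * star a - 1}

instance axIdeal.isStarIdeal (F : Type w) [RCLike F] (q : ℝ) : (axIdeal F q).IsStarIdeal :=
  starIdealSpan.isStarIdeal _

/-! Replacing `a* a` by `q a a*` and `x x*` by `1 - a a*` gives the quotient a basis of reduced
words. The two leading words do not overlap, so this needs no confluence check: the rewriting
defines an action on all words (`act`), and `mem_axIdeal_iff` describes the ideal by vanishing of
normal forms.

Realness follows from a linear functional that is positive on the relevant squares. In `star u * v`
with `u`, `v` reduced, cancellation happens only between leading letters `x*`; it leaves the product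
of the tails plus strictly longer words. The effective size of a word is thus the length of its
`core`. If `N` is the least core length occurring in the normal forms of all `bⱼ`, then `squareCoeff
F N` sees only the products `star u * u` with core length `N`, each with a coefficient `q ^ n > 0`
(`squareCoeff_act`). On `∑ star bⱼ * bⱼ` it is therefore a positive combination of some `‖f u‖ ^ 2`,
which cannot vanish.

In a representation killing the relations, the second one makes `π (star a)` a contraction and the
first one gives `‖π a v‖ ^ 2 = q ‖π (star a) v‖ ^ 2`; since an operator and its adjoint have the
same norm and `q < 1`, `π a = 0`. But `a` is not in the ideal, and this refutes both the
Nullstellensatz and O*-representability. -/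

/-! ### Words in the letters `a`, `a*`, `x`, `x*` -/

/-- The letters of the free *-algebra in `a` and `x`; the Boolean marks a starred letter. -/
abbrev AXLetter : Type := AXVar × Bool

namespace AXLetter

/-- The involution on letters. -/
def st (l : AXLetter) : AXLetter := (l.1, !l.2)

/-- Whether a letter is `a` or `a*`. -/
def isA : AXLetter → Bool
  | (AXVar.a, _) => true
  | (AXVar.x, _) => false

theorem st_st (l : AXLetter) : l.st.st = l := by simp [st]

theorem isA_st (l : AXLetter) : l.st.isA = l.isA := by
  rcases l with ⟨_ | _, _⟩ <;> rfl

/-- The letter `l` may be followed by `l'` in a reduced word: `a* a` and `x x*` are excluded. -/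
def Compat : AXLetter → AXLetter → Prop
  | (AXVar.a, true), (AXVar.a, false) => False
  | (AXVar.x, false), (AXVar.x, true) => False
  | _, _ => True

end AXLetter

namespace AXWord

open AXLetter

/-- Words containing neither `a* a` nor `x x*`. -/
def Reduced (w : List AXLetter) : Prop := w.IsChain Compat

/-- The word obtained from `a* w` by moving `a*` past the leading letters `a`. -/
def insertAStar : List AXLetter → List AXLetter
  | (AXVar.a, false) :: w => (AXVar.a, false) :: insertAStar w
  | w => (AXVar.a, true) :: w

/-- The number of leading letters `a`. -/
def leadCount : List AXLetter → ℕ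
  | (AXVar.a, false) :: w => leadCount w + 1
  | _ => 0

/-- Left multiplication by a letter, without cancellation of `x x*`. -/
def push : AXLetter → List AXLetter → List AXLetter
  | (AXVar.a, true), w => insertAStar w
  | l, w => l :: w

/-- The word representing `star u * v`, without cancellation of `x x*`. -/
def comb : List AXLetter → List AXLetter → List AXLetter
  | [], v => v
  | l :: u, v => comb u (push l.st v)

/-- The word with its leading letters `x*` removed. -/
def core : List AXLetter → List AXLetter
  | (AXVar.x, true) :: w => core w
  | w => w

theorem insertAStar_of_ne {w : List AXLetter} (h : ∀ t, w ≠ (AXVar.a, false) :: t) :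
    insertAStar w = (AXVar.a, true) :: w := by
  rcases w with _ | ⟨⟨_ | _, _ | _⟩, t⟩ <;> first | rfl | exact absurd rfl (h t)

theorem insertAStar_ne_nil (w : List AXLetter) : ∃ b t, insertAStar w = (AXVar.a, b) :: t := by
  rcases w with _ | ⟨⟨_ | _, _ | _⟩, t⟩ <;> exact ⟨_, _, rfl⟩

theorem length_insertAStar (w : List AXLetter) : (insertAStar w).length = w.length + 1 := by
  induction w with
  | nil => rfl
  | cons l w ih => rcases l with ⟨_ | _, _ | _⟩ <;> simp [insertAStar, ih]

theorem length_push (l : AXLetter) (w : List AXLetter) : (push l w).length = w.length + 1 := by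
  rcases l with ⟨_ | _, _ | _⟩ <;> simp [push, length_insertAStar]

theorem length_comb (u v : List AXLetter) : (comb u v).length = u.length + v.length := by
  induction u generalizing v with
  | nil => simp [comb]
  | cons l u ih => simp only [comb, ih, length_push, List.length_cons]; omega

/-- Moving `a*` past `a` permutes letters of the same type, so the pattern of types survives the
reordering and can be read off the factors. -/
theorem map_isA_insertAStar (w : List AXLetter) :
    (insertAStar w).map isA = true :: w.map isA := by
  induction w with
  | nil => rfl
  | cons l w ih => rcases l with ⟨_ | _, _ | _⟩ <;> simp [insertAStar, ih, isA]

theorem map_isA_push (l : AXLetter) (w : List AXLetter) :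
    (push l w).map isA = l.isA :: w.map isA := by
  rcases l with ⟨_ | _, _ | _⟩ <;> simp [push, map_isA_insertAStar, isA]

theorem map_isA_comb (u v : List AXLetter) :
    (comb u v).map isA = (u.map isA).reverse ++ v.map isA := by
  induction u generalizing v with
  | nil => simp [comb]
  | cons l u ih => simp [comb, ih, map_isA_push, isA_st]

theorem core_of_ne {w : List AXLetter} (h : ∀ t, w ≠ (AXVar.x, true) :: t) : core w = w := by
  rcases w with _ | ⟨⟨_ | _, _ | _⟩, t⟩ <;> first | rfl | exact absurd rfl (h t)

theorem length_core_le (w : List AXLetter) : (core w).length ≤ w.length := by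
  induction w with
  | nil => simp [core]
  | cons l w ih => rcases l with ⟨_ | _, _ | _⟩ <;> simp [core]; omega

theorem Reduced.tail {l : AXLetter} {w : List AXLetter} (h : Reduced (l :: w)) : Reduced w :=
  List.IsChain.tail h

theorem reduced_cons {l : AXLetter} {w : List AXLetter} (hw : Reduced w)
    (h : ∀ l' t, w = l' :: t → Compat l l') : Reduced (l :: w) := by
  rcases w with _ | ⟨l', t⟩
  · exact List.isChain_singleton _
  · exact List.isChain_cons_cons.2 ⟨h l' t rfl, hw⟩

theorem Reduced.compat {l l' : AXLetter} {w : List AXLetter} (h : Reduced (l :: l' :: w)) :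
    Compat l l' := (List.isChain_cons_cons.1 h).1

theorem Reduced.a_cons {w : List AXLetter} (hw : Reduced w) :
    Reduced ((AXVar.a, false) :: w) :=
  reduced_cons hw fun _ _ _ => trivial

theorem Reduced.insertAStar {w : List AXLetter} (hw : Reduced w) :
    Reduced (insertAStar w) := by
  induction w with
  | nil => exact List.isChain_singleton _
  | cons l w ih =>
    rcases l with ⟨_ | _, _ | _⟩
    · exact (ih hw.tail).a_cons
    all_goals exact reduced_cons hw (by rintro _ _ ⟨⟩; trivial)

theorem insertAStar_replicate (n : ℕ) {w : List AXLetter}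
    (h : ∀ t, w ≠ (AXVar.a, false) :: t) :
    insertAStar (List.replicate n (AXVar.a, false) ++ w) =
      List.replicate n (AXVar.a, false) ++ (AXVar.a, true) :: w := by
  induction n with
  | zero => simpa using insertAStar_of_ne h
  | succ n ih => simp [List.replicate_succ, insertAStar, ih]

theorem comb_eq_reverse_append {p v : List AXLetter} (hp : Reduced p)
    (h : ∀ s t, p = (AXVar.a, false) :: s → v ≠ (AXVar.a, false) :: t) :
    comb p v = (p.map st).reverse ++ v := by
  induction p generalizing v with
  | nil => simp [comb]
  | cons l p ih =>
    have hpush : push l.st v = l.st :: v := by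
      rcases l with ⟨_ | _, _ | _⟩
      · exact insertAStar_of_ne fun t => h _ t rfl
      all_goals rfl
    rw [comb, hpush, ih hp.tail]
    · simp
    · rintro s t rfl ht
      have := hp.compat
      rcases l with ⟨_ | _, _ | _⟩ <;> simp_all [st, Compat]

theorem comb_replicate_a (i n m : ℕ) {u p : List AXLetter}
    (hp : ∀ l t, p = l :: t → l.isA = false) :
    comb (List.replicate i (AXVar.a, false) ++ u)
        (List.replicate n (AXVar.a, false) ++ List.replicate m (AXVar.a, true) ++ p) =
      comb u (List.replicate n (AXVar.a, false) ++ List.replicate (i + m) (AXVar.a, true) ++ p) := by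
  induction i generalizing m with
  | zero => simp
  | succ i ih =>
    have : push (st (AXVar.a, false))
        (List.replicate n (AXVar.a, false) ++ List.replicate m (AXVar.a, true) ++ p) =
        List.replicate n (AXVar.a, false) ++ List.replicate (m + 1) (AXVar.a, true) ++ p := by
      rw [List.append_assoc]
      refine (insertAStar_replicate n ?_).trans ?_
      · intro t ht
        rcases m with _ | m
        · exact absurd (hp _ _ (by simpa using ht)) (by simp [isA])
        · simp [List.replicate_succ] at ht
      · simp [List.replicate_succ]
    rw [List.replicate_succ, List.cons_append, comb, this, ih]
    congr 4
    omega

theorem comb_replicate_aStar (j n : ℕ) (u v : List AXLetter) :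
    comb (List.replicate j (AXVar.a, true) ++ u) (List.replicate n (AXVar.a, false) ++ v) =
      comb u (List.replicate (n + j) (AXVar.a, false) ++ v) := by
  induction j generalizing n with
  | zero => simp
  | succ j ih =>
    have : push (st (AXVar.a, true)) (List.replicate n (AXVar.a, false) ++ v) =
        List.replicate (n + 1) (AXVar.a, false) ++ v := by
      simp [List.replicate_succ, push, st]
    rw [List.replicate_succ, List.cons_append, comb, this, ih]
    congr 3
    omega

/-- The adjoint of `a^i (a*)^j p` is `p* a^j (a*)^i`; its final `(a*)^i` passes `a^i'`, so the
exponents add crosswise. -/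
theorem comb_blocks (i j i' j' : ℕ) {p p' : List AXLetter} (hred : Reduced p)
    (hp : ∀ l t, p = l :: t → l.isA = false) (hp' : ∀ l t, p' = l :: t → l.isA = false) :
    comb (List.replicate i (AXVar.a, false) ++ (List.replicate j (AXVar.a, true) ++ p))
        (List.replicate i' (AXVar.a, false) ++ List.replicate j' (AXVar.a, true) ++ p') =
      (p.map st).reverse ++ ((List.replicate (i' + j) (AXVar.a, false) ++
        List.replicate (i + j') (AXVar.a, true)) ++ p') := by
  rw [comb_replicate_a _ _ _ hp', List.append_assoc, comb_replicate_aStar,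
    comb_eq_reverse_append hred, List.append_assoc]
  rintro s t rfl
  exact absurd (hp _ _ rfl) (by simp [isA])

theorem Reduced.exists_blocks {u : List AXLetter} (hu : Reduced u) :
    ∃ i j p, u = List.replicate i (AXVar.a, false) ++ (List.replicate j (AXVar.a, true) ++ p) ∧
      Reduced p ∧ ∀ l t, p = l :: t → l.isA = false := by
  induction u with
  | nil => exact ⟨0, 0, [], by simp, hu, by simp⟩
  | cons l u ih =>
    obtain ⟨i, j, p, rfl, hpr, hp⟩ := ih hu.tail
    rcases l with ⟨_ | _, _ | _⟩
    · exact ⟨i + 1, j, p, by simp [List.replicate_succ], hpr, hp⟩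
    · rcases i with _ | i
      · exact ⟨0, j + 1, p, by simp [List.replicate_succ], hpr, hp⟩
      · exact absurd hu.compat (by simp [Compat])
    all_goals
      exact ⟨0, 0, _, by simp only [List.replicate_zero, List.nil_append], hu, by rintro _ _ ⟨⟩; rfl⟩

theorem takeWhile_map_isA_blocks (i j : ℕ) {p : List AXLetter}
    (hp : ∀ l t, p = l :: t → l.isA = false) :
    (((List.replicate i (AXVar.a, false) ++ (List.replicate j (AXVar.a, true) ++ p)).map
      isA).takeWhile id).length = i + j := by
  induction i with
  | zero =>
    induction j with
    | zero =>
      rcases p with _ | ⟨l, t⟩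
      · simp
      · simp [hp l t rfl]
    | succ j ih => simpa [List.replicate_succ, isA] using ih
  | succ i ih =>
    rw [List.replicate_succ, List.cons_append, List.map_cons, List.takeWhile_cons_of_pos (by rfl),
      List.length_cons, ih]
    omega

/-- Distinct squares can share a word (`a* a` and `a a*` both yield `a a*`), but no mixed product
lands on the word of a square. The type pattern fixes the total lengths of the initial `a`-blocks,
and the central block then fixes how they split. -/
theorem eq_of_comb_eq_comb_self {u v w : List AXLetter} (hu : Reduced u) (hv : Reduced v)
    (hw : Reduced w) (huw : u.length = w.length) (hvw : v.length = w.length)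
    (h : comb u v = comb w w) : u = v := by
  have hmap := congrArg (List.map isA) h
  rw [map_isA_comb, map_isA_comb] at hmap
  obtain ⟨h1, h2⟩ := List.append_inj hmap (by simp [huw])
  have h1 := congrArg (fun z => (z.takeWhile id).length) (List.reverse_injective h1)
  have h2 := congrArg (fun z => (z.takeWhile id).length) h2
  obtain ⟨i, j, p, rfl, hpr, hp⟩ := hu.exists_blocks
  obtain ⟨i', j', p', rfl, hpr', hp'⟩ := hv.exists_blocks
  obtain ⟨k, l, r, rfl, hrr, hr⟩ := hw.exists_blocks
  simp only [takeWhile_map_isA_blocks _ _ hp, takeWhile_map_isA_blocks _ _ hp',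
    takeWhile_map_isA_blocks _ _ hr] at h1 h2
  simp only [List.length_append, List.length_replicate] at huw hvw
  have e1 := comb_blocks i j i' j' hpr hp hp'
  have e2 := comb_blocks k l k l hrr hr hr
  rw [List.append_assoc] at e1 e2
  rw [e1, e2] at h
  obtain ⟨h3, h4⟩ := List.append_inj h (by simp; omega)
  obtain ⟨h5, h6⟩ := List.append_inj h4 (by simp; omega)
  have hpe : p = r := by
    have hinj : Function.Injective st := fun a b hab => by rw [← st_st a, hab, st_st]
    exact List.map_injective_iff.2 hinj (List.reverse_injective h3)
  -- Counting starred letters in the central block gives `i + j' = k + l`; since also `i + j = k + l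
  -- = i' + j'`, the exponents agree.
  have h7 := congrArg (List.countP fun l => l.2) h5
  simp only [List.countP_append, List.countP_replicate, Bool.false_eq_true, if_false, if_true,
    zero_add] at h7
  obtain rfl : j = j' := by omega
  obtain rfl : i = i' := by omega
  rw [hpe, h6]

end AXWord

/-! ### The action of the free *-algebra on words -/

theorem FreeStarAlgebra.induction {F : Type w} [RCLike F] {G : Type v}
    {motive : FreeStarAlgebra F G → Prop}
    (scalar : ∀ r : F, motive (algebraMap F (FreeStarAlgebra F G) r))
    (letter : ∀ l : G × Bool, motive (FreeStarAlgebra.letter F l.1 l.2))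
    (mul : ∀ a b, motive a → motive b → motive (a * b))
    (add : ∀ a b, motive a → motive b → motive (a + b)) (p : FreeStarAlgebra F G) : motive p :=
  FreeAlgebra.induction (R := F) (X := G × Bool) (motive := motive) scalar letter mul add p

namespace AXWord

open AXLetter FreeStarAlgebra

variable {F : Type w} [RCLike F]

/-- The reduction of `l w` modulo `a* a = c a a*` and `x x* = 1 - a a*`. -/
noncomputable def letterAct (c : F) : AXLetter → List AXLetter → (List AXLetter →₀ F)
  | (AXVar.a, false), w => Finsupp.single ((AXVar.a, false) :: w) 1
  | (AXVar.a, true), w => Finsupp.single (insertAStar w) (c ^ leadCount w)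
  | (AXVar.x, true), w => Finsupp.single ((AXVar.x, true) :: w) 1
  | (AXVar.x, false), (AXVar.x, true) :: w =>
      Finsupp.single w 1 - Finsupp.single ((AXVar.a, false) :: insertAStar w) (c ^ leadCount w)
  | (AXVar.x, false), w => Finsupp.single ((AXVar.x, false) :: w) 1

/-- The linear extension of `letterAct`. -/
noncomputable def letterOp (c : F) (l : AXLetter) : Module.End F (List AXLetter →₀ F) :=
  Finsupp.linearCombination F (letterAct c l)

/-- The action of the free *-algebra on linear combinations of words. -/
noncomputable def act (c : F) :
    FreeStarAlgebra F AXVar →ₐ[F] Module.End F (List AXLetter →₀ F) :=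
  FreeAlgebra.lift F (letterOp c)

theorem act_letter (c : F) (l : AXLetter) : act c (letter F l.1 l.2) = letterOp c l :=
  FreeAlgebra.lift_ι_apply (R := F) (letterOp c) l

theorem letterOp_single (c : F) (l : AXLetter) (w : List AXLetter) :
    letterOp c l (Finsupp.single w 1) = letterAct c l w := by
  simp [letterOp]

theorem letterOp_single_push (c : F) (l : AXLetter) (w : List AXLetter)
    (h : l = (AXVar.x, false) → ∀ t, w ≠ (AXVar.x, true) :: t) :
    ∃ n : ℕ, letterOp c l (Finsupp.single w 1) = c ^ n • Finsupp.single (push l w) 1 := by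
  rw [letterOp_single]
  rcases l with ⟨_ | _, _ | _⟩
  · exact ⟨0, by simp [letterAct, push]⟩
  · exact ⟨leadCount w, by simp [letterAct, push]⟩
  · refine ⟨0, ?_⟩
    rcases w with _ | ⟨⟨_ | _, _ | _⟩, t⟩
    case x.false.cons.x.true => exact absurd rfl (h rfl t)
    all_goals simp [letterAct, push]
  · exact ⟨0, by simp [letterAct, push]⟩

theorem letterOp_x_single (c : F) (w : List AXLetter) :
    letterOp c (AXVar.x, false) (Finsupp.single ((AXVar.x, true) :: w) 1) =
      Finsupp.single w 1 -
        c ^ leadCount w • Finsupp.single ((AXVar.a, false) :: insertAStar w) 1 := by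
  rw [letterOp_single]
  simp [letterAct]

/-- The product of the letters of a word. -/
noncomputable def wordProd (F : Type w) [RCLike F] (w : List AXLetter) : FreeStarAlgebra F AXVar :=
  (w.map fun l => letter F l.1 l.2).prod

theorem wordProd_cons (l : AXLetter) (w : List AXLetter) :
    wordProd F (l :: w) = letter F l.1 l.2 * wordProd F w := by
  simp [wordProd]

theorem act_star_wordProd_cons (c : F) (l : AXLetter) (u : List AXLetter)
    (v : List AXLetter →₀ F) :
    act c (star (wordProd F (l :: u))) v = act c (star (wordProd F u)) (letterOp c l.st v) := by
  rw [wordProd_cons, star_mul, star_letter, map_mul, Module.End.mul_apply]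
  exact congrArg (fun T => act c (star (wordProd F u)) (T v)) (act_letter c l.st)

theorem act_star_wordProd_nil (c : F) (v : List AXLetter →₀ F) :
    act c (star (wordProd F [])) v = v := by
  simp [wordProd]

/-- After the first letter of `u`, a cancellation would need `x` followed by `x*` inside `u`, which
reducedness forbids; the hypothesis `h` excludes it at the first letter. -/
theorem act_star_wordProd_single {c : F} {u v : List AXLetter} (hu : Reduced u)
    (h : ∀ s t, u = (AXVar.x, true) :: s → v ≠ (AXVar.x, true) :: t) :
    ∃ n : ℕ, act c (star (wordProd F u)) (Finsupp.single v 1) =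
      c ^ n • Finsupp.single (comb u v) 1 := by
  induction u generalizing v with
  | nil => exact ⟨0, by simp [act_star_wordProd_nil, comb]⟩
  | cons l u ih =>
    obtain ⟨n, hn⟩ := letterOp_single_push c l.st v (by
      intro hl t
      refine h u t ?_
      rw [← st_st l, hl]
      rfl)
    obtain ⟨m, hm⟩ := ih (v := push l.st v) hu.tail (by
      rintro s t rfl ht
      have := hu.compat
      rcases l with ⟨_ | _, _ | _⟩
      · obtain ⟨b, r, hr⟩ := insertAStar_ne_nil v
        simp [push, st, hr] at ht
      all_goals simp_all [push, st, Compat])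
    exact ⟨n + m, by rw [act_star_wordProd_cons, hn, map_smul, hm, smul_smul, pow_add, comb]⟩

/-! ### Length filtration and the positive functional -/

/-- The span of the words of length at least `n`. -/
noncomputable def longWords (F : Type w) [RCLike F] (n : ℕ) : Submodule F (List AXLetter →₀ F) :=
  Finsupp.supported F F {w | n ≤ w.length}

theorem single_mem_longWords {n : ℕ} {w : List AXLetter} (h : n ≤ w.length) :
    Finsupp.single w 1 ∈ longWords F n :=
  Finsupp.single_mem_supported F 1 h

theorem longWords_anti {m n : ℕ} (h : m ≤ n) : longWords F n ≤ longWords F m :=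
  Finsupp.supported_mono fun _ hw => le_trans h hw

theorem exists_cons_or_forall_ne (w : List AXLetter) :
    (∃ t, w = (AXVar.x, true) :: t) ∨ ∀ t, w ≠ (AXVar.x, true) :: t := by
  by_cases h : ∃ t, w = (AXVar.x, true) :: t
  · exact Or.inl h
  · exact Or.inr fun t ht => h ⟨t, ht⟩

/-- Only leading letters `x*` of `u` and `v` can cancel each other, and `core` discounts exactly
these. -/
theorem act_star_wordProd_mem_longWords (c : F) {u : List AXLetter} (v : List AXLetter)
    (hu : Reduced u) :
    act c (star (wordProd F u)) (Finsupp.single v 1) ∈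
      longWords F ((core u).length + (core v).length) := by
  induction u generalizing v with
  | nil =>
    rw [act_star_wordProd_nil]
    exact single_mem_longWords (by simpa [core] using length_core_le v)
  | cons l u ih =>
    rcases exists_cons_or_forall_ne (l :: u) with ⟨t, ht⟩ | hne
    · obtain ⟨rfl, rfl⟩ := List.cons.inj ht
      rw [act_star_wordProd_cons]
      change act c _ (letterOp c (AXVar.x, false) _) ∈ _
      rcases exists_cons_or_forall_ne v with ⟨v, rfl⟩ | hv
      · rw [letterOp_x_single, map_sub, map_smul]
        refine sub_mem (ih v hu.tail) (Submodule.smul_mem _ _ (longWords_anti ?_ (ih _ hu.tail)))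
        have := length_core_le v
        simp only [core, List.length_cons, length_insertAStar]
        omega
      · obtain ⟨n, hn⟩ := letterOp_single_push c (AXVar.x, false) v fun _ => hv
        rw [hn, map_smul]
        refine Submodule.smul_mem _ _ (longWords_anti ?_ (ih _ hu.tail))
        rw [core_of_ne hv]
        simp only [core, push, List.length_cons]
        omega
    · obtain ⟨n, hn⟩ := act_star_wordProd_single (c := c) (v := v) hu
        fun s t hs => absurd hs (hne s)
      rw [hn]
      refine Submodule.smul_mem _ _ (single_mem_longWords ?_)
      rw [length_comb]
      exact add_le_add (length_core_le _) (length_core_le _)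

/-- The words that represent `star w * w` for a reduced word `w` of length `N`. -/
def squareWords (N : ℕ) : Set (List AXLetter) :=
  {z | ∃ w, Reduced w ∧ w.length = N ∧ z = comb w w}

open Classical in
/-- The sum of the coefficients at the words of `squareWords N`. -/
noncomputable def squareCoeff (F : Type w) [RCLike F] (N : ℕ) : (List AXLetter →₀ F) →ₗ[F] F :=
  Finsupp.linearCombination F fun z => if z ∈ squareWords N then 1 else 0

open Classical in
theorem squareCoeff_single (N : ℕ) (z : List AXLetter) :
    squareCoeff F N (Finsupp.single z 1) = if z ∈ squareWords N then 1 else 0 := by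
  simp [squareCoeff]

theorem squareCoeff_eq_zero {N n : ℕ} (h : 2 * N < n) {v : List AXLetter →₀ F}
    (hv : v ∈ longWords F n) : squareCoeff F N v = 0 := by
  classical
  rw [squareCoeff, Finsupp.linearCombination_apply]
  refine Finset.sum_eq_zero fun z hz => ?_
  refine smul_eq_zero_of_right _ (if_neg ?_)
  rintro ⟨w, -, hw, rfl⟩
  have : n ≤ (comb w w).length := hv hz
  rw [length_comb] at this
  omega

open Classical in
-- This is orthogonality of reduced words at the lowest level: common leading letters `x*` are
-- stripped by induction, every by-product is longer than `2 * N`, and the remaining case is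
-- `eq_of_comb_eq_comb_self`.
theorem squareCoeff_act (c : F) {N : ℕ} {u v : List AXLetter} (hu : Reduced u)
    (hv : Reduced v) (hNu : N ≤ (core u).length) (hNv : N ≤ (core v).length) :
    ∃ n : ℕ, squareCoeff F N (act c (star (wordProd F u)) (Finsupp.single v 1)) =
      if u = v ∧ (core u).length = N then c ^ n else 0 := by
  induction u generalizing v with
  | nil =>
    obtain rfl : N = 0 := by simpa [core] using hNu
    refine ⟨0, ?_⟩
    rw [act_star_wordProd_nil, squareCoeff_single, pow_zero]
    refine if_congr ?_ rfl rfl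
    constructor
    · rintro ⟨w, -, hw, rfl⟩
      obtain rfl := List.length_eq_zero_iff.1 hw
      simp [comb, core]
    · rintro ⟨rfl, -⟩
      exact ⟨[], hu, rfl, rfl⟩
  | cons l u ih =>
    rcases exists_cons_or_forall_ne (l :: u) with ⟨t, ht⟩ | hne
    · obtain ⟨rfl, rfl⟩ := List.cons.inj ht
      rw [act_star_wordProd_cons]
      change ∃ n : ℕ, squareCoeff F N (act c _ (letterOp c (AXVar.x, false) _)) = _
      simp only [core] at hNu
      rcases exists_cons_or_forall_ne v with ⟨v, rfl⟩ | hv'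
      · simp only [core] at hNv
        obtain ⟨n, hn⟩ := ih hu.tail hv.tail hNu hNv
        refine ⟨n, ?_⟩
        -- The correction `a a* v` starts with an `a`-letter, so its core is the whole word, two
        -- letters longer than `v`; it lies beyond length `2 * N`.
        rw [letterOp_x_single, map_sub, map_sub, hn, map_smul, map_smul,
          squareCoeff_eq_zero _ (act_star_wordProd_mem_longWords c _ hu.tail), smul_zero, sub_zero]
        · simp [core]
        · have := length_core_le v
          simp only [core, List.length_cons, length_insertAStar]
          omega
      · obtain ⟨n, hn⟩ := letterOp_single_push c (AXVar.x, false) v fun _ => hv'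
        refine ⟨0, ?_⟩
        -- Here `x v` is its own core, one letter longer than that of `v`, which already exceeds the
        -- bound.
        rw [hn, map_smul, map_smul,
          squareCoeff_eq_zero _ (act_star_wordProd_mem_longWords c _ hu.tail), smul_zero, if_neg]
        · rintro ⟨h, -⟩
          exact hv' _ h.symm
        · rw [core_of_ne hv'] at hNv
          simp only [core, push, List.length_cons]
          omega
    · rw [core_of_ne hne] at hNu ⊢
      obtain ⟨n, hn⟩ := act_star_wordProd_single (c := c) (v := v) hu
        fun s t hs => absurd hs (hne s)
      refine ⟨n, ?_⟩
      rw [hn, map_smul, squareCoeff_single, smul_eq_mul, mul_ite, mul_one, mul_zero]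
      refine if_congr ⟨?_, ?_⟩ rfl rfl
      · rintro ⟨w, hw, rfl, h⟩
        have hlen := congrArg List.length h
        rw [length_comb, length_comb] at hlen
        have := length_core_le v
        exact ⟨eq_of_comb_eq_comb_self hu hv hw (by omega) (by omega) h, by omega⟩
      · rintro ⟨rfl, h⟩
        exact ⟨_, hu, h, rfl⟩

/-! ### Normal forms -/

/-- The span of the reduced words. -/
noncomputable def reducedWords (F : Type w) [RCLike F] : Submodule F (List AXLetter →₀ F) :=
  Finsupp.supported F F {w | Reduced w}

theorem letterAct_mem_reducedWords (c : F) (l : AXLetter) {w : List AXLetter} (hw : Reduced w) :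
    letterAct c l w ∈ reducedWords F := by
  have key (z : List AXLetter) (d : F) (hz : Reduced z) :
      Finsupp.single z d ∈ reducedWords F := Finsupp.single_mem_supported F d hz
  rcases l with ⟨_ | _, _ | _⟩
  · exact key _ _ hw.a_cons
  · exact key _ _ hw.insertAStar
  · rcases w with _ | ⟨⟨_ | _, _ | _⟩, t⟩
    case x.false.cons.x.true =>
      exact sub_mem (key _ _ hw.tail) (key _ _ hw.tail.insertAStar.a_cons)
    all_goals exact key _ _ (reduced_cons hw (by rintro _ _ ⟨⟩ <;> trivial))
  · exact key _ _ (reduced_cons hw fun _ _ _ => trivial)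

theorem letterOp_mem_reducedWords (c : F) (l : AXLetter) {v : List AXLetter →₀ F}
    (hv : v ∈ reducedWords F) : letterOp c l v ∈ reducedWords F := by
  rw [letterOp, Finsupp.linearCombination_apply]
  exact Submodule.sum_mem _ fun w hw =>
    Submodule.smul_mem _ _ (letterAct_mem_reducedWords c l (hv hw))

theorem act_mem_reducedWords (c : F) (p : FreeStarAlgebra F AXVar) {v : List AXLetter →₀ F}
    (hv : v ∈ reducedWords F) : act c p v ∈ reducedWords F := by
  induction p using FreeStarAlgebra.induction generalizing v with
  | scalar r =>
    rw [AlgHom.commutes, Module.algebraMap_end_apply]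
    exact Submodule.smul_mem _ r hv
  | letter l =>
    rw [act_letter]
    exact letterOp_mem_reducedWords c l hv
  | mul a b ha hb =>
    rw [map_mul]
    exact ha (hb hv)
  | add a b ha hb =>
    rw [map_add]
    exact add_mem (ha hv) (hb hv)

/-- The coordinates of `p` in the reduced words, modulo the relations. -/
noncomputable def normalForm (c : F) (p : FreeStarAlgebra F AXVar) : List AXLetter →₀ F :=
  act c p (Finsupp.single [] 1)

theorem reduced_of_mem_support_normalForm {c : F} {p : FreeStarAlgebra F AXVar}
    {w : List AXLetter} (hw : w ∈ (normalForm c p).support) : Reduced w :=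
  act_mem_reducedWords c p (Finsupp.single_mem_supported F 1 List.isChain_nil) hw

/-! ### The ideal as the kernel of the action -/

theorem letterOp_aStar_a (c : F) :
    letterOp c (AXVar.a, true) * letterOp c (AXVar.a, false) =
      c • (letterOp c (AXVar.a, false) * letterOp c (AXVar.a, true)) := by
  refine Finsupp.lhom_ext' fun w => LinearMap.ext_ring ?_
  simp only [LinearMap.comp_apply, Module.End.mul_apply, LinearMap.smul_apply,
    Finsupp.lsingle_apply, letterOp_single, letterAct]
  simp [letterOp, letterAct, insertAStar, leadCount, pow_succ']

theorem letterOp_x_xStar (c : F) :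
    letterOp c (AXVar.x, false) * letterOp c (AXVar.x, true) +
      letterOp c (AXVar.a, false) * letterOp c (AXVar.a, true) = 1 := by
  refine Finsupp.lhom_ext' fun w => LinearMap.ext_ring ?_
  simp only [LinearMap.comp_apply, Module.End.mul_apply, LinearMap.add_apply,
    Finsupp.lsingle_apply, letterOp_single, letterAct]
  simp [letterOp, letterAct]

theorem star_aRelation (q : ℝ) :
    star (star (var F AXVar.a) * var F AXVar.a - (q : F) • (var F AXVar.a * star (var F AXVar.a))) =
      star (var F AXVar.a) * var F AXVar.a -
        (q : F) • (var F AXVar.a * star (var F AXVar.a)) := by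
  simp

theorem star_xRelation :
    star (var F AXVar.x * star (var F AXVar.x) + var F AXVar.a * star (var F AXVar.a) - 1) =
      var F AXVar.x * star (var F AXVar.x) + var F AXVar.a * star (var F AXVar.a) - 1 := by
  simp

/-- The elements that act as zero together with their adjoints. -/
noncomputable def actKernel (c : F) : Ideal (FreeStarAlgebra F AXVar) where
  carrier := {p | act c p = 0 ∧ act c (star p) = 0}
  zero_mem' := by simp
  add_mem' ha hb := by
    simp only [Set.mem_ofPred_eq] at *
    simp [ha, hb]
  smul_mem' r p hp := by
    simp only [Set.mem_ofPred_eq] at *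
    simp [hp]

instance actKernel.isStarIdeal (c : F) : (actKernel c).IsStarIdeal where
  star_mem_iff p := by
    change act c (star p) = 0 ∧ act c (star (star p)) = 0 ↔ act c p = 0 ∧ act c (star p) = 0
    rw [star_star, and_comm]

theorem act_var (c : F) (g : AXVar) : act c (var F g) = letterOp c (g, false) :=
  act_letter c (g, false)

theorem act_star_var (c : F) (g : AXVar) : act c (star (var F g)) = letterOp c (g, true) := by
  rw [var, star_letter]
  exact act_letter c (g, true)

/-- Minimality of the generated *-ideal applies only to *-ideals, hence the symmetrized kernel; the
generators are self-adjoint, so one check each suffices. -/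
theorem axIdeal_le_actKernel (q : ℝ) : axIdeal F q ≤ actKernel (q : F) := by
  refine sInf_le ⟨inferInstance, ?_⟩
  rintro _ (rfl | rfl)
  · refine (and_iff_left_of_imp fun h => ?_).2 ?_
    · rwa [star_aRelation]
    · rw [map_sub, map_smul, map_mul, map_mul, act_var, act_star_var, letterOp_aStar_a, sub_self]
  · refine (and_iff_left_of_imp fun h => ?_).2 ?_
    · rwa [star_xRelation]
    · rw [map_sub, map_add, map_mul, map_mul, map_one, act_var, act_star_var, act_var,
        act_star_var, letterOp_x_xStar, sub_self]

theorem act_eq_zero_of_mem {q : ℝ} {p : FreeStarAlgebra F AXVar} (hp : p ∈ axIdeal F q) :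
    act (q : F) p = 0 :=
  (axIdeal_le_actKernel q hp).1

theorem subset_axIdeal (q : ℝ) :
    star (var F AXVar.a) * var F AXVar.a - (q : F) • (var F AXVar.a * star (var F AXVar.a)) ∈
        axIdeal F q ∧
      var F AXVar.x * star (var F AXVar.x) + var F AXVar.a * star (var F AXVar.a) - 1 ∈
        axIdeal F q := by
  constructor <;> refine Submodule.mem_sInf.2 fun J hJ => hJ.2 ?_ <;> simp

/-- The class of a linear combination of words in the quotient. -/
noncomputable def quotientEval (F : Type w) [RCLike F] (q : ℝ) :
    (List AXLetter →₀ F) →ₗ[F] FreeStarAlgebra F AXVar ⧸ axIdeal F q :=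
  Finsupp.linearCombination F fun w => Ideal.Quotient.mk (axIdeal F q) (wordProd F w)

theorem quotientEval_single (q : ℝ) (w : List AXLetter) (r : F) :
    quotientEval F q (Finsupp.single w r) =
      r • Ideal.Quotient.mk (axIdeal F q) (wordProd F w) := by
  simp [quotientEval]

end AXWord

namespace AXWord

open AXLetter FreeStarAlgebra

variable {F : Type w} [RCLike F]

theorem quotient_aStar_mul_a (q : ℝ) :
    Ideal.Quotient.mk (axIdeal F q) (letter F AXVar.a true) *
        Ideal.Quotient.mk (axIdeal F q) (letter F AXVar.a false) =
      (q : F) • (Ideal.Quotient.mk (axIdeal F q) (letter F AXVar.a false) *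
        Ideal.Quotient.mk (axIdeal F q) (letter F AXVar.a true)) := by
  have h := (subset_axIdeal (F := F) q).1
  rw [var, star_letter] at h
  exact Ideal.Quotient.eq.2 h

theorem quotient_x_mul_xStar (q : ℝ) :
    Ideal.Quotient.mk (axIdeal F q) (letter F AXVar.x false) *
        Ideal.Quotient.mk (axIdeal F q) (letter F AXVar.x true) =
      1 - Ideal.Quotient.mk (axIdeal F q) (letter F AXVar.a false) *
        Ideal.Quotient.mk (axIdeal F q) (letter F AXVar.a true) := by
  have h := (subset_axIdeal (F := F) q).2
  rw [var, var, star_letter, star_letter] at h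
  rw [eq_sub_iff_add_eq]
  exact Ideal.Quotient.eq.2 h

theorem quotient_aStar_mul_wordProd (q : ℝ) (w : List AXLetter) :
    Ideal.Quotient.mk (axIdeal F q) (letter F AXVar.a true) *
        Ideal.Quotient.mk (axIdeal F q) (wordProd F w) =
      (q : F) ^ leadCount w • Ideal.Quotient.mk (axIdeal F q) (wordProd F (insertAStar w)) := by
  induction w with
  | nil => simp [wordProd, leadCount, insertAStar]
  | cons l w ih =>
    rcases l with ⟨_ | _, _ | _⟩
    · rw [wordProd_cons, map_mul, ← mul_assoc, quotient_aStar_mul_a, smul_mul_assoc, mul_assoc, ih,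
        mul_smul_comm, smul_smul, leadCount, pow_succ', insertAStar, wordProd_cons, map_mul]
    all_goals simp [leadCount, insertAStar, wordProd_cons]

theorem quotientEval_letterOp (q : ℝ) (l : AXLetter) (v : List AXLetter →₀ F) :
    quotientEval F q (letterOp (q : F) l v) =
      Ideal.Quotient.mk (axIdeal F q) (letter F l.1 l.2) * quotientEval F q v := by
  suffices h : quotientEval F q ∘ₗ letterOp (q : F) l =
      LinearMap.mulLeft F (Ideal.Quotient.mk (axIdeal F q) (letter F l.1 l.2)) ∘ₗ
        quotientEval F q from LinearMap.congr_fun h v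
  refine Finsupp.lhom_ext' fun w => LinearMap.ext_ring ?_
  simp only [LinearMap.comp_apply, Finsupp.lsingle_apply, letterOp_single,
    LinearMap.mulLeft_apply, quotientEval_single, one_smul]
  have hcons (l : AXLetter) (w : List AXLetter) :
      quotientEval F q (Finsupp.single (l :: w) 1) =
        Ideal.Quotient.mk (axIdeal F q) (letter F l.1 l.2) *
          Ideal.Quotient.mk (axIdeal F q) (wordProd F w) := by
    rw [quotientEval_single, one_smul, wordProd_cons, map_mul]
  rcases l with ⟨_ | _, _ | _⟩
  · exact hcons _ _
  · rw [quotient_aStar_mul_wordProd]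
    exact quotientEval_single _ _ _
  · rcases w with _ | ⟨⟨_ | _, _ | _⟩, t⟩
    case x.false.cons.x.true =>
      rw [letterAct, map_sub, quotientEval_single, quotientEval_single, wordProd_cons,
        wordProd_cons, map_mul, map_mul, ← mul_assoc, quotient_x_mul_xStar, sub_mul, one_mul,
        one_smul, mul_assoc, quotient_aStar_mul_wordProd, mul_smul_comm]
    all_goals exact hcons _ _
  · exact hcons _ _

theorem quotientEval_act (q : ℝ) (p : FreeStarAlgebra F AXVar) (v : List AXLetter →₀ F) :
    quotientEval F q (act (q : F) p v) =
      Ideal.Quotient.mk (axIdeal F q) p * quotientEval F q v := by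
  induction p using FreeStarAlgebra.induction generalizing v with
  | scalar r =>
    rw [AlgHom.commutes, Module.algebraMap_end_apply, map_smul]
    exact Algebra.smul_def r (quotientEval F q v)
  | letter l => rw [act_letter, quotientEval_letterOp]
  | mul a b ha hb => rw [map_mul, Module.End.mul_apply, ha, hb, map_mul, mul_assoc]
  | add a b ha hb => rw [map_add, LinearMap.add_apply, map_add, ha, hb, map_add, add_mul]

theorem quotientEval_normalForm (q : ℝ) (p : FreeStarAlgebra F AXVar) :
    quotientEval F q (normalForm (q : F) p) = Ideal.Quotient.mk (axIdeal F q) p := by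
  rw [normalForm, quotientEval_act, quotientEval_single]
  simp [wordProd]

/-- Forward, the relations hold for the action; backward, evaluating the normal form in the quotient
recovers the class of `p`. -/
theorem mem_axIdeal_iff {q : ℝ} {p : FreeStarAlgebra F AXVar} :
    p ∈ axIdeal F q ↔ normalForm (q : F) p = 0 := by
  constructor
  · intro hp
    rw [normalForm, act_eq_zero_of_mem hp, LinearMap.zero_apply]
  · intro hp
    rw [← Ideal.Quotient.eq_zero_iff_mem, ← quotientEval_normalForm, hp, map_zero]

theorem var_a_notMem_axIdeal (q : ℝ) : var F AXVar.a ∉ axIdeal F q := by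
  rw [mem_axIdeal_iff, normalForm, act_var, letterOp_single]
  simp [letterAct]

/-! ### Positivity -/

/-- The element `p` differs from the combination of words in its normal form by a member of the
ideal, and the ideal is closed under `star`. -/
theorem act_star_eq_sum (q : ℝ) (p : FreeStarAlgebra F AXVar) (v : List AXLetter →₀ F) :
    act (q : F) (star p) v = ∑ u ∈ (normalForm (q : F) p).support,
      star (normalForm (q : F) p u) • act (q : F) (star (wordProd F u)) v := by
  set r : FreeStarAlgebra F AXVar :=
    ∑ u ∈ (normalForm (q : F) p).support, normalForm (q : F) p u • wordProd F u with hr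
  have hpr : p - r ∈ axIdeal F q := by
    rw [← Ideal.Quotient.eq, ← quotientEval_normalForm, quotientEval,
      Finsupp.linearCombination_apply, hr, map_sum]
    rfl
  have h := act_eq_zero_of_mem (((axIdeal.isStarIdeal F q).star_mem_iff _).2 hpr)
  rw [star_sub, map_sub, sub_eq_zero] at h
  rw [h, hr, star_sum, map_sum, LinearMap.sum_apply]
  refine Finset.sum_congr rfl fun u _ => ?_
  rw [star_smul, map_smul, LinearMap.smul_apply]

theorem squareCoeff_normalForm_star_mul_self {q : ℝ} (hq : 0 < q) {N : ℕ}
    (p : FreeStarAlgebra F AXVar)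
    (hN : ∀ u ∈ (normalForm (q : F) p).support, N ≤ (core u).length) :
    ∃ r : ℝ, squareCoeff F N (normalForm (q : F) (star p * p)) = r ∧ 0 ≤ r ∧
      ((∃ u ∈ (normalForm (q : F) p).support, (core u).length = N) → 0 < r) := by
  classical
  set f := normalForm (q : F) p with hf
  have hred (u) (hu : u ∈ f.support) : Reduced u := reduced_of_mem_support_normalForm hu
  have key (u : List AXLetter) : ∃ k : ℝ, 0 ≤ k ∧ ((core u).length = N → 0 < k) ∧
      (u ∈ f.support → squareCoeff F N (act (q : F) (star (wordProd F u)) f) = f u * k) := by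
    by_cases hu : u ∈ f.support
    · obtain ⟨n, hn⟩ := squareCoeff_act (q : F) (hred u hu) (hred u hu) (hN u hu) (hN u hu)
      refine ⟨if (core u).length = N then q ^ n else 0, by positivity, fun h => ?_, fun _ => ?_⟩
      · rw [if_pos h]
        positivity
      · conv_lhs => rw [← Finsupp.sum_single f, Finsupp.sum]
        rw [map_sum, map_sum, Finset.sum_eq_single u]
        · rw [← mul_one (f u), ← smul_eq_mul, ← Finsupp.smul_single, map_smul, map_smul, hn]
          split_ifs <;> simp_all
        · intro v hv hvu
          obtain ⟨m, hm⟩ := squareCoeff_act (q : F) (hred u hu) (hred v hv) (hN u hu) (hN v hv)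
          rw [← mul_one (f v), ← smul_eq_mul, ← Finsupp.smul_single, map_smul, map_smul, hm,
            if_neg fun h => hvu h.1.symm, smul_zero]
        · exact fun h => absurd hu h
    -- Outside the support the weight is never used; any positive value serves.
    · exact ⟨1, zero_le_one, fun _ => one_pos, fun h => absurd h hu⟩
  choose k hk0 hkpos hk using key
  refine ⟨∑ u ∈ f.support, ‖f u‖ ^ 2 * k u, ?_, ?_, ?_⟩
  · rw [normalForm, map_mul, Module.End.mul_apply, ← normalForm, ← hf, act_star_eq_sum, ← hf,
      map_sum, RCLike.ofReal_sum]
    refine Finset.sum_congr rfl fun u hu => ?_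
    rw [map_smul, hk u hu, smul_eq_mul, ← mul_assoc, RCLike.star_def, RCLike.conj_mul]
    push_cast
    rfl
  · exact Finset.sum_nonneg fun u _ => mul_nonneg (sq_nonneg _) (hk0 u)
  · rintro ⟨u, hu, huN⟩
    refine Finset.sum_pos' (fun u _ => mul_nonneg (sq_nonneg _) (hk0 u)) ⟨u, hu, ?_⟩
    have := Finsupp.mem_support_iff.1 hu
    have := hkpos u huN
    positivity

/-- The minimal core length must be taken over all summands at once, so that one functional is
nonnegative on each and positive on at least one. -/
theorem mem_axIdeal_of_sum_mem {q : ℝ} (hq : 0 < q) {n : ℕ} (b : Fin n → FreeStarAlgebra F AXVar)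
    (h : ∑ j, star (b j) * b j ∈ axIdeal F q) (j : Fin n) : b j ∈ axIdeal F q := by
  classical
  by_contra hj
  rw [mem_axIdeal_iff] at hj
  obtain ⟨u₀, hu₀⟩ := Finsupp.support_nonempty_iff.2 hj
  have hex : ∃ N, ∃ i, ∃ u ∈ (normalForm (q : F) (b i)).support, (core u).length = N :=
    ⟨_, j, u₀, hu₀, rfl⟩
  obtain ⟨i, u, hu, huN⟩ := Nat.find_spec hex
  have hmin (i) (u) (hu : u ∈ (normalForm (q : F) (b i)).support) :
      Nat.find hex ≤ (core u).length := Nat.find_min' hex ⟨i, u, hu, rfl⟩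
  choose r hr hr0 hrpos using fun i => squareCoeff_normalForm_star_mul_self hq (b i) (hmin i)
  have hsum : normalForm (q : F) (∑ j, star (b j) * b j) =
      ∑ j, normalForm (q : F) (star (b j) * b j) := by
    simp only [normalForm, map_sum, LinearMap.sum_apply]
  have h0 := congrArg (squareCoeff F (Nat.find hex)) (mem_axIdeal_iff.1 h)
  rw [hsum, map_sum, map_zero, Finset.sum_congr rfl fun i _ => hr i, ← RCLike.ofReal_sum,
    RCLike.ofReal_eq_zero] at h0
  have hpos : 0 < ∑ i, r i :=
    Finset.sum_pos' (fun i _ => hr0 i) ⟨i, Finset.mem_univ i, hrpos i ⟨u, hu, huN⟩⟩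
  exact hpos.ne' h0

theorem axIdeal_isReal {q : ℝ} (hq : 0 < q) : (axIdeal F q).IsReal := by
  rintro n b ⟨u, hu, v, hv, h⟩
  refine mem_axIdeal_of_sum_mem hq b ?_
  rw [h]
  exact add_mem hu (((axIdeal.isStarIdeal F q).star_mem_iff v).2 hv)

end AXWord

/-! ### Consequences of realness -/

theorem Ideal.realRadical_eq_self {A : Type v} [Ring A] [StarRing A] {I : Ideal A}
    (hI : I.IsReal) : I.realRadical = I :=
  le_antisymm (sInf_le ⟨hI, le_rfl⟩) (le_sInf fun _ hJ => hJ.2)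

theorem Ideal.IsReal.starFormallyReal_quotient {A : Type v} [Ring A] [StarRing A] {I : Ideal A}
    [I.IsStarIdeal] (hI : I.IsReal) : StarFormallyReal (A ⧸ I) := by
  intro n a ha j
  choose b hb using fun j => Ideal.Quotient.mk_surjective (a j)
  rw [← hb j, Ideal.Quotient.eq_zero_iff_mem]
  refine hI n b ⟨_, ?_, 0, I.zero_mem, by rw [star_zero, add_zero]⟩ j
  rw [← Ideal.Quotient.eq_zero_iff_mem, map_sum, ← ha]
  refine Finset.sum_congr rfl fun j _ => ?_
  rw [map_mul, ← Ideal.Quotient.star_mk, hb]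

/-! ### Operators on pre-Hilbert spaces -/

/-- The estimate `‖S v‖ ^ 4 ≤ ‖T (S v)‖ ^ 2 * ‖v‖ ^ 2 = q * ‖S (S v)‖ ^ 2 * ‖v‖ ^ 2` improves any
bound `‖S v‖ ^ 2 ≤ C * ‖v‖ ^ 2` by a factor `q`. Iterating from `C = 1` uses Cauchy-Schwarz only,
without completeness. -/
theorem Module.End.eq_zero_of_adjoint_relations {F : Type w} [RCLike F] {V : Type u}
    [NormedAddCommGroup V] [InnerProductSpace F V] {q : ℝ} (hq0 : 0 < q) (hq1 : q < 1)
    {S T X Y : Module.End F V} (hST : ∀ v w, inner F (T v) w = inner F v (S w))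
    (hXY : ∀ v w, inner F (X v) w = inner F v (Y w)) (h1 : S * T = (q : F) • (T * S))
    (h2 : X * Y + T * S = 1) : T = 0 := by
  have hT (v : V) : ‖T v‖ ^ 2 = q * ‖S v‖ ^ 2 := by
    rw [← inner_self_eq_norm_sq (𝕜 := F) (T v), ← inner_self_eq_norm_sq (𝕜 := F) (S v), hST,
      ← Module.End.mul_apply, h1, LinearMap.smul_apply, inner_smul_right, RCLike.re_ofReal_mul,
      inner_re_symm, Module.End.mul_apply, hST]
  have hS (v : V) : ‖S v‖ ^ 2 = RCLike.re (inner F (T (S v)) v) := by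
    rw [hST, inner_self_eq_norm_sq]
  have hS1 (v : V) : ‖S v‖ ^ 2 ≤ ‖v‖ ^ 2 := by
    have hY : ‖Y v‖ ^ 2 = RCLike.re (inner F (X (Y v)) v) := by
      rw [hXY, inner_self_eq_norm_sq]
    have h : X (Y v) + T (S v) = v := LinearMap.congr_fun h2 v
    have h' : ‖v‖ ^ 2 = ‖Y v‖ ^ 2 + ‖S v‖ ^ 2 := by
      rw [hY, hS, ← map_add, ← inner_add_left, h, inner_self_eq_norm_sq]
    rw [h']
    exact le_add_of_nonneg_left (sq_nonneg _)
  have hSn (n : ℕ) (v : V) : ‖S v‖ ^ 2 ≤ q ^ n * ‖v‖ ^ 2 := by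
    induction n generalizing v with
    | zero => simpa using hS1 v
    | succ n ih =>
      -- The case `S v = 0` is split off because the final step cancels `‖S v‖ ^ 2`.
      rcases (norm_nonneg (S v)).eq_or_lt' with h0 | h0
      · rw [h0, zero_pow two_ne_zero]
        positivity
      have h3 : ‖S v‖ ^ 2 ≤ ‖T (S v)‖ * ‖v‖ := by
        rw [hS]
        exact re_inner_le_norm _ _
      have h4 : ‖T (S v)‖ ^ 2 ≤ q ^ (n + 1) * ‖S v‖ ^ 2 := by
        rw [hT, pow_succ' q, mul_assoc]
        exact mul_le_mul_of_nonneg_left (ih _) hq0.le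
      have h5 : ‖S v‖ ^ 2 * ‖S v‖ ^ 2 ≤ (q ^ (n + 1) * ‖v‖ ^ 2) * ‖S v‖ ^ 2 :=
        calc ‖S v‖ ^ 2 * ‖S v‖ ^ 2 = (‖S v‖ ^ 2) ^ 2 := by ring
          _ ≤ (‖T (S v)‖ * ‖v‖) ^ 2 := pow_le_pow_left₀ (sq_nonneg _) h3 2
          _ = ‖T (S v)‖ ^ 2 * ‖v‖ ^ 2 := by ring
          _ ≤ q ^ (n + 1) * ‖S v‖ ^ 2 * ‖v‖ ^ 2 := by gcongr
          _ = _ := by ring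
      exact le_of_mul_le_mul_right h5 (by positivity)
  ext v
  have hlim : Filter.Tendsto (fun n : ℕ => q ^ n * ‖v‖ ^ 2) Filter.atTop (nhds 0) := by
    simpa using (tendsto_pow_atTop_nhds_zero_of_lt_one hq0.le hq1).mul_const (‖v‖ ^ 2)
  have h0 : ‖S v‖ ^ 2 ≤ 0 := ge_of_tendsto' hlim fun n => hSn n v
  have h6 : ‖T v‖ ^ 2 ≤ 0 := by
    rw [hT]
    exact mul_nonpos_of_nonneg_of_nonpos hq0.le h0
  have h7 : ‖T v‖ = 0 := pow_eq_zero_iff two_ne_zero |>.1 (le_antisymm h6 (sq_nonneg _))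
  simpa using h7

theorem StarRep.π_eq_zero_of_relations {F : Type w} [RCLike F] {A : Type v} [Ring A] [Algebra F A]
    [StarRing A] (ρ : StarRep.{u} F A) {q : ℝ} (hq0 : 0 < q) (hq1 : q < 1) {a x : A}
    (h1 : ρ.π (star a * a - (q : F) • (a * star a)) = 0)
    (h2 : ρ.π (x * star x + a * star a - 1) = 0) : ρ.π a = 0 := by
  refine Module.End.eq_zero_of_adjoint_relations hq0 hq1 (ρ.inner_star a) (ρ.inner_star x) ?_ ?_
  · rwa [map_sub, map_smul, map_mul, map_mul, sub_eq_zero] at h1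
  · rwa [map_sub, map_add, map_mul, map_mul, map_one, sub_eq_zero] at h2

theorem proposition1p7 (F : Type w) [RCLike F] (q : ℝ) (hq0 : 0 < q) (hq1 : q < 1) :
    (axIdeal F q).IsReal ∧
    (∀ C : Set (StarRep.{u} F (FreeStarAlgebra F AXVar)),
      ¬ SatisfiesRealNullstellensatz C (axIdeal F q)) ∧
    StarFormallyReal (FreeStarAlgebra F AXVar ⧸ axIdeal F q) ∧
    ¬ IsOStarRepresentable.{u} F (FreeStarAlgebra F AXVar ⧸ axIdeal F q) := by
  have hreal : (axIdeal F q).IsReal := AXWord.axIdeal_isReal hq0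
  have ha := AXWord.var_a_notMem_axIdeal (F := F) q
  obtain ⟨h1, h2⟩ := AXWord.subset_axIdeal (F := F) q
  refine ⟨hreal, fun C hC => ha ?_, hreal.starFormallyReal_quotient, ?_⟩
  · have hmem : FreeStarAlgebra.var F AXVar.a ∈ hardRadical C (axIdeal F q : Set _) :=
      fun ρ hρ => ρ.π_eq_zero_of_relations hq0 hq1 (hρ.2 _ h1) (hρ.2 _ h2)
    rw [hC, Ideal.realRadical_eq_self hreal] at hmem
    exact hmem
  · rintro ⟨ρ, hρ⟩
    refine ha (Ideal.Quotient.eq_zero_iff_mem.1 (hρ ?_))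
    rw [map_zero]
    refine ρ.π_eq_zero_of_relations hq0 hq1
      (x := Ideal.Quotient.mk (axIdeal F q) (FreeStarAlgebra.var F AXVar.x)) ?_ ?_
    · exact (congrArg ρ.π (Ideal.Quotient.eq_zero_iff_mem.2 h1)).trans (map_zero _)
    · exact (congrArg ρ.π (Ideal.Quotient.eq_zero_iff_mem.2 h2)).trans (map_zero _)
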